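/- A \emph{preposet} $P$ is a set with a reflexive relation $\le$ whose transitive closure $\preceq$ is antisymmetric (so every poset is a preposet); a \emph{chain} of $P$ is a subset any two elements of which are related by $\le$ in at least one direction; a \emph{monotone map} is a map preserving the relation. A poset is \emph{conditionally complete} if each nonempty subset that has an upper bound has a least upper bound. Identify $p\in P$ with the characteristic function of the cone $\{q\in P\mid q\preceq p\}$ in $[0,1]^P$, where $[0,1]^P$ has the sup metric; the \emph{geometric realization} $|P|\subset[0,1]^P$ is the union of the convex hulls of all nonempty finite chains of $P$, with the induced metric. A monotone map $g\colon P\to Q$ extends to a map $|g|\colon|P|\to|Q|$ that is affine on the convex hull of each finite chain. The \emph{canonical subdivision} $P^{\#}$ is the preposet of all intervals $[\sigma,\tau]$ with $\sigma\le\tau$ in $P$, where $[\sigma,\tau]\le[\sigma',\tau']$ if and only if $\sigma'\le\sigma\le\tau\le\tau'$ and also $\sigma'\le\tau$, $\sigma\le\tau'$ (for a poset, this is inclusion of intervals). Let $h\colon|P^{\#}|\to|P|$ be the canonical bijection which sends the vertex $[\sigma,\tau]$ to the midpoint of the segment with endpoints $\sigma$ and $\tau$ and is affine on the convex hull of each finite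 chain of $P^{\#}$. Iterating yields $P^{\#m}$ and bijections $h_m\colon|P^{\#m}|\to|P|$ for $m\ge 0$. \textbf{Theorem.} For each $\varepsilon>0$ there exists an $n$ such that the following holds. Let $f\colon|P|\to|Q|$ be a uniformly continuous map, where $P$ is a preposet and $Q$ is a conditionally complete poset. Then there exists an $M$ such that for each $m\ge M$ there exists a monotone map $g\colon P^{\#m}\to Q^{\#n}$ such that the composition $$|P|\xrightarrow{\,h_m^{-1}\,}|P^{\#m}|\xrightarrow{\,|g|\,}|Q^{\#n}|\xrightarrow{\,h_n\,}|Q|$$ is $\varepsilon$-close to $f$, that is, $d\bigl(h_n(|g|(h_m^{-1}(x))),f(x)\bigr)<\varepsilon$ for all $x\in|P|$. -/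

import Mathlib

universe u v

open scoped ENNReal

/-- A preposet: a set with a reflexive relation without directed cycles of length greater
than one, i.e. a reflexive relation whose transitive closure is antisymmetric. -/
structure Preposet : Type (u + 1) where
  carrier : Type u
  rel : carrier → carrier → Prop
  refl : ∀ p, rel p p
  acyclic : ∀ p q, Relation.TransGen rel p q → Relation.TransGen rel q p → p = q

namespace Preposet

instance : CoeSort Preposet.{u} (Type u) := ⟨Preposet.carrier⟩

/-- A poset, regarded as a preposet. -/
@[reducible] def ofPoset (Q : Type u) [PartialOrder Q] : Preposet.{u} where
  carrier := Q
  rel := fun p q => p ≤ q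
  refl := fun p => le_refl p
  acyclic := by
    intro p q h h'
    rw [Relation.transGen_eq_self] at h h'
    exact le_antisymm h h'

/-- The transitive closure of a preposet `P`, as a partial order on the same underlying set. -/
@[reducible] def closureOrder (P : Preposet.{u}) : PartialOrder P where
  le := Relation.TransGen P.rel
  le_refl := fun p => Relation.TransGen.single (P.refl p)
  le_trans := fun _ _ _ h h' => h.trans h'
  le_antisymm := P.acyclic

/-- A monotone map of preposets. -/
structure Hom (P : Preposet.{u}) (Q : Preposet.{v}) where
  toFun : P → Q
  monotone : ∀ p q, P.rel p q → Q.rel (toFun p) (toFun q)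

/-! ### Geometric realization -/

/-- The vertex of the cube `[0,1]^P ⊆ ℓ^∞(P)` corresponding to `p`: the characteristic function
of the cone `{q | q ≤ p}` of `p` in the transitive closure of `P`. -/
noncomputable def vertex (P : Preposet.{u}) (p : P) : lp (fun _ : P => ℝ) ∞ :=
  ⟨Set.indicator {q | Relation.TransGen P.rel q p} 1, by
    refine memℓp_infty ⟨1, ?_⟩
    rintro _ ⟨q, rfl⟩
    by_cases h : q ∈ {q | Relation.TransGen P.rel q p} <;> simp [h]⟩

/-- The geometric realization of `P` as a subset of `ℓ^∞(P)`, with the sup metric: the union of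
the convex hulls of all nonempty finite chains of `P`. -/
def realizationSet (P : Preposet.{u}) : Set (lp (fun _ : P => ℝ) ∞) :=
  {x | ∃ C : Finset P, C.Nonempty ∧ IsChain P.rel (C : Set P) ∧
    x ∈ convexHull ℝ (P.vertex '' (C : Set P))}

/-- The geometric realization `|P|`, a metric space. -/
abbrev Realization (P : Preposet.{u}) : Type u := ↥P.realizationSet

/-- Barycentric coordinates: a finitely supported probability weight on `P` whose support
is a chain. -/
@[ext] structure Bary (P : Preposet.{u}) where
  weight : P →₀ ℝ
  nonneg : ∀ p, 0 ≤ weight p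
  total : (weight.sum fun _ t => t) = 1
  chain : IsChain P.rel (weight.support : Set P)

/-- The point of `ℓ^∞(P)` with the given barycentric coordinates. -/
noncomputable def Bary.point {P : Preposet.{u}} (w : P.Bary) : lp (fun _ : P => ℝ) ∞ :=
  w.weight.sum fun p t => t • P.vertex p

/-- The total weight of a subset. -/
noncomputable def mass {α : Type u} (S : Set α) : (α →₀ ℝ) →ₗ[ℝ] ℝ :=
  Finsupp.linearCombination ℝ (S.indicator 1)

theorem mass_eq_sum {α : Type u} (S : Set α) (w : α →₀ ℝ) :
    mass S w = ∑ p ∈ w.support, w p * S.indicator 1 p := by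
  simp [mass, Finsupp.linearCombination_apply, Finsupp.sum]

theorem mass_univ {α : Type u} (w : α →₀ ℝ) : mass Set.univ w = w.sum fun _ t => t := by
  simp [mass_eq_sum, Finsupp.sum]

theorem mass_nonneg {α : Type u} (S : Set α) (w : α →₀ ℝ) (hw : ∀ p, 0 ≤ w p) :
    0 ≤ mass S w := by
  rw [mass_eq_sum]
  exact Finset.sum_nonneg fun p _ => mul_nonneg (hw p) (Set.indicator_nonneg (by simp) p)

theorem mass_mono {α : Type u} (S T : Set α) (w : α →₀ ℝ) (hw : ∀ p, 0 ≤ w p)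
    (h : ∀ p ∈ w.support, p ∈ S → p ∈ T) : mass S w ≤ mass T w := by
  rw [mass_eq_sum, mass_eq_sum]
  refine Finset.sum_le_sum fun p hp => mul_le_mul_of_nonneg_left ?_ (hw p)
  by_cases h1 : p ∈ S
  · simp [h1, h p hp h1]
  · simpa [h1] using Set.indicator_nonneg (by simp) p

theorem mass_congr {α : Type u} (S T : Set α) (w : α →₀ ℝ)
    (h : ∀ p ∈ w.support, (p ∈ S ↔ p ∈ T)) : mass S w = mass T w := by
  rw [mass_eq_sum, mass_eq_sum]
  refine Finset.sum_congr rfl fun p hp => ?_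
  by_cases h1 : p ∈ S
  · simp [h1, (h p hp).1 h1]
  · have h2 : p ∉ T := fun h2 => h1 ((h p hp).2 h2)
    simp [h1, h2]

/-- A finitely supported function on a poset is determined by its sums over the dual cones. -/
theorem eq_of_mass_Ici {α : Type u} [PartialOrder α] (w w' : α →₀ ℝ)
    (h : ∀ p, mass (Set.Ici p) w = mass (Set.Ici p) w') : w = w' := by
  by_contra hne
  obtain ⟨p, hp⟩ := (w - w').support.exists_maximal
    (Finsupp.support_nonempty_iff.2 (sub_ne_zero.2 hne))
  have h1 : mass (Set.Ici p) (w - w') = 0 := by rw [map_sub, h p, sub_self]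
  rw [mass_eq_sum, Finset.sum_eq_single p] at h1
  · simp only [Set.mem_Ici, le_refl, Set.indicator_of_mem, Pi.one_apply, mul_one] at h1
    exact (Finsupp.mem_support_iff.1 hp.1) h1
  · intro q hq hqp
    rw [Set.indicator_of_notMem, mul_zero]
    exact fun hpq => hqp (le_antisymm (hp.2 hq hpq) hpq)
  · exact fun h2 => absurd hp.1 h2

theorem Bary.point_apply {P : Preposet.{u}} (w : P.Bary) (q : P) :
    w.point q = mass {p | Relation.TransGen P.rel q p} w.weight := by
  rw [mass_eq_sum, Bary.point, Finsupp.sum, lp.coeFn_sum, Finset.sum_apply]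
  refine Finset.sum_congr rfl fun p _ => ?_
  rw [lp.coeFn_smul, Pi.smul_apply, smul_eq_mul]
  congr 1

theorem Bary.point_injective (P : Preposet.{u}) :
    Function.Injective (Bary.point : P.Bary → lp (fun _ : P => ℝ) ∞) := by
  intro w w' h
  let := P.closureOrder
  refine Bary.ext (eq_of_mass_Ici _ _ fun p => ?_)
  have h1 := w.point_apply p
  rw [h, w'.point_apply p] at h1
  exact h1.symm

theorem Bary.point_mem {P : Preposet.{u}} (w : P.Bary) : w.point ∈ P.realizationSet := by
  refine ⟨w.weight.support, ?_, w.chain, ?_⟩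
  · rw [Finsupp.support_nonempty_iff]
    intro h
    simpa [h] using w.total
  · exact (convex_convexHull ℝ _).sum_mem (fun p _ => w.nonneg p) w.total
      fun p hp => subset_convexHull ℝ _ ⟨p, hp, rfl⟩

theorem Bary.exists_point_eq {P : Preposet.{u}} {x : lp (fun _ : P => ℝ) ∞}
    (hx : x ∈ P.realizationSet) : ∃ w : P.Bary, w.point = x := by
  classical
  obtain ⟨C, -, hC, hx⟩ := hx
  obtain ⟨ι, _, w, z, hw0, hw1, hz, rfl⟩ := mem_convexHull_iff_exists_fintype.1 hx
  choose p hpC hp using hz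
  have hsum : ∀ {N : Type u} [AddCommGroup N] [Module ℝ N] (φ : P → N),
      Finsupp.linearCombination ℝ φ (∑ i, Finsupp.single (p i) (w i)) = ∑ i, w i • φ (p i) := by
    intro N _ _ φ
    simp [map_sum]
  refine ⟨⟨∑ i, Finsupp.single (p i) (w i), ?_, ?_, ?_⟩, ?_⟩
  · intro q
    rw [Finsupp.finsetSum_apply]
    refine Finset.sum_nonneg fun i _ => ?_
    rw [Finsupp.single_apply]
    split_ifs
    · exact hw0 i
    · exact le_rfl
  · rw [← mass_univ, mass, map_sum]
    simpa using hw1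
  · refine hC.mono fun q hq => ?_
    have h1 := Finsupp.support_finsetSum (Finset.mem_coe.1 hq)
    simp only [Finset.mem_biUnion, Finset.mem_univ, true_and] at h1
    obtain ⟨i, hi⟩ := h1
    have h2 := Finsupp.support_single_subset hi
    rw [Finset.mem_singleton] at h2
    exact h2 ▸ hpC i
  · refine (hsum P.vertex).trans ?_
    simp [hp]

/-- Points of `|P|` correspond bijectively to barycentric coordinates. -/
noncomputable def baryEquiv (P : Preposet.{u}) : P.Bary ≃ P.Realization :=
  Equiv.ofBijective (fun w => ⟨w.point, w.point_mem⟩)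
    ⟨fun _ _ h => Bary.point_injective P (congrArg Subtype.val h),
      fun x => (Bary.exists_point_eq x.2).imp fun _ h => Subtype.ext h⟩

theorem mass_mapDomain {α : Type u} {β : Type v} (φ : α → β) (S : Set β) (w : α →₀ ℝ) :
    mass S (w.mapDomain φ) = mass (φ ⁻¹' S) w := by
  rw [mass, Finsupp.linearCombination_mapDomain]
  rfl

theorem mapDomain_nonneg {α : Type u} {β : Type v} (φ : α → β) (w : α →₀ ℝ)
    (hw : ∀ p, 0 ≤ w p) (q : β) : 0 ≤ w.mapDomain φ q := by
  classical
  rw [Finsupp.mapDomain, Finsupp.sum, Finsupp.finsetSum_apply]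
  refine Finset.sum_nonneg fun i _ => ?_
  rw [Finsupp.single_apply]
  split_ifs
  · exact hw i
  · exact le_rfl

/-- The action of a monotone map on barycentric coordinates. -/
noncomputable def Hom.baryMap {P : Preposet.{u}} {Q : Preposet.{v}} (g : Hom P Q) (w : P.Bary) :
    Q.Bary where
  weight := w.weight.mapDomain g.toFun
  nonneg := mapDomain_nonneg _ _ w.nonneg
  total := by
    rw [← mass_univ, mass_mapDomain, Set.preimage_univ, mass_univ, w.total]
  chain := by
    classical
    have h := Finsupp.mapDomain_support (f := g.toFun) (s := w.weight)
    intro a ha b hb hab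
    obtain ⟨p, hp, rfl⟩ := Finset.mem_image.1 (h ha)
    obtain ⟨q, hq, rfl⟩ := Finset.mem_image.1 (h hb)
    exact (w.chain hp hq fun e => hab (congrArg _ e)).imp (g.monotone p q) (g.monotone q p)

/-- The geometric realization `|g| : |P| → |Q|` of a monotone map: it sends vertices to vertices
by `g`, and is affine on the convex hull of every chain. -/
noncomputable def Hom.realize {P : Preposet.{u}} {Q : Preposet.{v}} (g : Hom P Q) :
    P.Realization → Q.Realization :=
  fun x => Q.baryEquiv (g.baryMap (P.baryEquiv.symm x))

/-! ### Canonical subdivision -/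

/-- An element `[left, right]` of the canonical subdivision. -/
@[ext] structure Interval (P : Preposet.{u}) : Type u where
  left : P
  right : P
  le : P.rel left right

/-- The canonical subdivision `P^#`: the intervals `[σ, τ]` with `σ ≤ τ`, where
`[σ, τ]` precedes `[σ', τ']` iff `σ' ≤ σ ≤ τ ≤ τ'` is a chain of `P`, that is, all the relations
`σ' ≤ σ`, `σ' ≤ τ`, `σ' ≤ τ'`, `σ ≤ τ`, `σ ≤ τ'`, `τ ≤ τ'` hold. If `P` is a poset, this is
the inclusion of intervals. -/
@[reducible] def sharp (P : Preposet.{u}) : Preposet.{u} where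
  carrier := P.Interval
  rel := fun I J => P.rel J.left I.left ∧ P.rel I.right J.right ∧
    P.rel J.left I.right ∧ P.rel I.left J.right
  refl := fun I => ⟨P.refl _, P.refl _, I.le, I.le⟩
  acyclic := by
    have key : ∀ I J : P.Interval,
        Relation.TransGen (fun I J : P.Interval => P.rel J.left I.left ∧ P.rel I.right J.right ∧
          P.rel J.left I.right ∧ P.rel I.left J.right) I J →
        Relation.TransGen P.rel J.left I.left ∧ Relation.TransGen P.rel I.right J.right := by
      intro I J h
      induction h with
      | single h => exact ⟨.single h.1, .single h.2.1⟩
      | tail _ h ih => exact ⟨.head h.1 ih.1, ih.2.tail h.2.1⟩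
    intro I J h h'
    have h1 := key _ _ h
    have h2 := key _ _ h'
    exact Interval.ext (P.acyclic _ _ h2.1 h1.1) (P.acyclic _ _ h1.2 h2.2)

/-- The effect of the canonical homeomorphism `|P^#| → |P|` on weights: the weight of an interval
`[σ, τ]` is split evenly between `σ` and `τ`. -/
noncomputable def halve {P : Preposet.{u}} (w : P.Interval →₀ ℝ) : P.carrier →₀ ℝ :=
  (1 / 2 : ℝ) • (w.mapDomain Interval.left + w.mapDomain Interval.right)

theorem mass_halve {P : Preposet.{u}} (w : P.Interval →₀ ℝ) (S : Set P) :
    mass S (halve w) =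
      (mass {I : P.Interval | I.left ∈ S} w + mass {I : P.Interval | I.right ∈ S} w) / 2 := by
  rw [halve, map_smul, map_add, mass_mapDomain, mass_mapDomain, smul_eq_mul]
  simp only [Set.preimage]
  ring

/-- The canonical map `|P^#| → |P|` in barycentric coordinates. -/
noncomputable def canonicalBary (P : Preposet.{u}) (w : P.sharp.Bary) : P.Bary where
  weight := halve w.weight
  nonneg := fun p => by
    have h1 := mapDomain_nonneg (Interval.left (P := P)) w.weight w.nonneg p
    have h2 := mapDomain_nonneg (Interval.right (P := P)) w.weight w.nonneg p
    simp only [halve, Finsupp.smul_apply, Finsupp.add_apply, smul_eq_mul]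
    positivity
  total := by
    have h := w.total
    rw [← mass_univ] at h ⊢
    rw [mass_halve]
    have h' : mass (Set.univ : Set P.Interval) w.weight = 1 := h
    simp only [Set.mem_univ, Set.ofPred_true]
    rw [h']
    norm_num
  chain := by
    classical
    have key : ∀ p ∈ (halve w.weight).support,
        ∃ I ∈ w.weight.support, p = Interval.left I ∨ p = Interval.right I := by
      intro p hp
      have h1 := Finsupp.support_add (Finsupp.support_smul hp)
      rcases Finset.mem_union.1 h1 with h | h
      · obtain ⟨I, hI, rfl⟩ := Finset.mem_image.1 (Finsupp.mapDomain_support h)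
        exact ⟨I, hI, Or.inl rfl⟩
      · obtain ⟨I, hI, rfl⟩ := Finset.mem_image.1 (Finsupp.mapDomain_support h)
        exact ⟨I, hI, Or.inr rfl⟩
    intro a ha b hb _
    obtain ⟨I, hI, ha⟩ := key a ha
    obtain ⟨J, hJ, hb⟩ := key b hb
    have hIJ : P.sharp.rel I J ∨ P.sharp.rel J I := by
      by_cases e : I = J
      · exact Or.inl (e ▸ P.sharp.refl I)
      · exact w.chain hI hJ e
    have hI' := Interval.le I
    have hJ' := Interval.le J
    rcases hIJ with ⟨h1, h2, h3, h4⟩ | ⟨h1, h2, h3, h4⟩ <;>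
      rcases ha with rfl | rfl <;> rcases hb with rfl | rfl <;> tauto

/-- The weight of the intervals containing `[a, b]` (in the transitive closure) is determined
by the image. -/
theorem mass_interval (P : Preposet.{u}) (w : P.sharp.Bary) (a b : P) :
    mass {I : P.Interval | Relation.TransGen P.rel I.left a ∧ Relation.TransGen P.rel b I.right}
      w.weight =
    min (min 1 (2 * mass {p : P | Relation.TransGen P.rel p a} (halve w.weight)))
      (min 1 (2 * mass {p : P | Relation.TransGen P.rel b p} (halve w.weight))) := by
  let := P.closureOrder
  have hle : ∀ I : P.Interval, I.left ≤ I.right := fun I => Relation.TransGen.single I.le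
  have hch : ∀ I ∈ w.weight.support, ∀ J ∈ w.weight.support,
      ((Interval.left J : P) ≤ Interval.left I ∧ (Interval.right I : P) ≤ Interval.right J) ∨
      ((Interval.left I : P) ≤ Interval.left J ∧ (Interval.right J : P) ≤ Interval.right I) := by
    intro I hI J hJ
    by_cases e : I = J
    · exact Or.inl (e ▸ ⟨le_rfl, le_rfl⟩)
    · rcases w.chain hI hJ e with h | h
      · exact Or.inl ⟨.single h.1, .single h.2.1⟩
      · exact Or.inr ⟨.single h.1, .single h.2.1⟩
  have htot : mass (Set.univ : Set P.Interval) w.weight = 1 := by rw [mass_univ]; exact w.total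
  have hle1 : ∀ S : Set P.Interval, mass S w.weight ≤ 1 := fun S =>
    (mass_mono S Set.univ w.weight w.nonneg fun _ _ _ => trivial).trans_eq htot
  have hpos : ∀ S : Set P.Interval, 0 ≤ mass S w.weight := fun S =>
    mass_nonneg S w.weight w.nonneg
  have hzero : ∀ S : Set P.Interval, (∀ I ∈ w.weight.support, I ∉ S) → mass S w.weight = 0 := by
    intro S hS
    rw [mass_eq_sum]
    exact Finset.sum_eq_zero fun I hI => by rw [Set.indicator_of_notMem (hS I hI), mul_zero]
  have hone : ∀ S : Set P.Interval, (∀ I ∈ w.weight.support, I ∈ S) → mass S w.weight = 1 := by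
    intro S hS
    rw [← htot]
    exact mass_congr S Set.univ w.weight fun I hI => by simp [hS I hI]
  have hA : min 1 (2 * mass {p : P | p ≤ a} (halve w.weight)) =
      mass {I : P.Interval | I.left ≤ a} w.weight := by
    rw [mass_halve]
    by_cases h : ∃ I ∈ w.weight.support, (Interval.right I : P) ≤ a
    · obtain ⟨I, hI, hIa⟩ := h
      have h1 := hone {I : P.Interval | I.left ≤ a} fun J hJ => by
        rcases hch I hI J hJ with h | h
        · exact h.1.trans ((hle I).trans hIa)
        · exact (hle J).trans (h.2.trans hIa)
      have h2 := hpos {I : P.Interval | I.right ≤ a}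
      simp only [Set.mem_ofPred_eq] at h1 h2 ⊢
      rw [h1, min_eq_left]
      linarith
    · push Not at h
      have h1 := hzero {I : P.Interval | I.right ≤ a} h
      have h2 := hle1 {I : P.Interval | I.left ≤ a}
      simp only [Set.mem_ofPred_eq] at h1 h2 ⊢
      rw [h1, min_eq_right] <;> linarith
  have hB : min 1 (2 * mass {p : P | b ≤ p} (halve w.weight)) =
      mass {I : P.Interval | b ≤ I.right} w.weight := by
    rw [mass_halve]
    by_cases h : ∃ I ∈ w.weight.support, b ≤ (Interval.left I : P)
    · obtain ⟨I, hI, hIa⟩ := h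
      have h1 := hone {I : P.Interval | b ≤ I.right} fun J hJ => by
        rcases hch I hI J hJ with h | h
        · exact hIa.trans ((hle I).trans h.2)
        · exact hIa.trans (h.1.trans (hle J))
      have h2 := hpos {I : P.Interval | b ≤ I.left}
      simp only [Set.mem_ofPred_eq] at h1 h2 ⊢
      rw [h1, min_eq_left]
      linarith
    · push Not at h
      have h1 := hzero {I : P.Interval | b ≤ I.left} h
      have h2 := hle1 {I : P.Interval | b ≤ I.right}
      simp only [Set.mem_ofPred_eq] at h1 h2 ⊢
      rw [h1, min_eq_right] <;> linarith
  change mass {I : P.Interval | I.left ≤ a ∧ b ≤ I.right} w.weight =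
    min (min 1 (2 * mass {p : P | p ≤ a} (halve w.weight)))
      (min 1 (2 * mass {p : P | b ≤ p} (halve w.weight)))
  rw [hA, hB]
  by_cases hsub : ∀ I ∈ w.weight.support, (Interval.left I : P) ≤ a → b ≤ Interval.right I
  · rw [min_eq_left (mass_mono {I : P.Interval | I.left ≤ a} {I | b ≤ I.right} w.weight
      w.nonneg hsub)]
    exact mass_congr _ _ w.weight fun I hI => ⟨fun h => h.1, fun h => ⟨h, hsub I hI h⟩⟩
  · have hsub' : ∀ I ∈ w.weight.support, b ≤ (Interval.right I : P) → Interval.left I ≤ a := by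
      push Not at hsub
      obtain ⟨J, hJ, hJa, hJb⟩ := hsub
      intro I hI hb
      rcases hch I hI J hJ with h | h
      · exact absurd (hb.trans h.2) hJb
      · exact h.1.trans hJa
    rw [min_eq_right (mass_mono {I : P.Interval | b ≤ I.right} {I | I.left ≤ a} w.weight
      w.nonneg hsub')]
    exact mass_congr _ _ w.weight fun I hI => ⟨fun h => h.2, fun h => ⟨hsub' I hI h, h⟩⟩

theorem canonicalBary_injective (P : Preposet.{u}) : Function.Injective P.canonicalBary := by
  intro w w' h
  have hw : halve w.weight = halve w'.weight := congrArg Bary.weight h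
  let : PartialOrder P.Interval :=
    { le := fun I J => Relation.TransGen P.rel J.left I.left ∧
        Relation.TransGen P.rel I.right J.right
      le_refl := fun I => ⟨.single (P.refl _), .single (P.refl _)⟩
      le_trans := fun I J K h h' => ⟨h'.1.trans h.1, h.2.trans h'.2⟩
      le_antisymm := fun I J h h' =>
        Interval.ext (P.acyclic _ _ h'.1 h.1) (P.acyclic _ _ h.2 h'.2) }
  refine Bary.ext ?_
  refine eq_of_mass_Ici (α := P.Interval) _ _ fun J => ?_
  have h1 := P.mass_interval w J.left J.right
  have h2 := P.mass_interval w' J.left J.right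
  rw [hw, ← h2] at h1
  exact h1

theorem exists_halve_eq (P : Preposet.{u}) (k : ℕ) : ∀ w : P.carrier →₀ ℝ,
    w.support.card ≤ k → (∀ p, 0 ≤ w p) → IsChain P.rel (w.support : Set P) →
    ∃ U : P.Interval →₀ ℝ, (∀ I, 0 ≤ U I) ∧ IsChain P.sharp.rel (U.support : Set P.Interval) ∧
      halve U = w ∧ ∀ I ∈ U.support, I.left ∈ w.support ∧ I.right ∈ w.support := by
  classical
  have hhalve : ∀ (I : P.Interval) (t : ℝ), halve (Finsupp.single I (2 * t)) =
      Finsupp.single I.left t + Finsupp.single I.right t := by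
    intro I t
    rw [halve, Finsupp.mapDomain_single, Finsupp.mapDomain_single, smul_add,
      Finsupp.smul_single, Finsupp.smul_single, smul_eq_mul, one_div, inv_mul_cancel_left₀ two_ne_zero]
  have hadd : ∀ U V : P.Interval →₀ ℝ, halve (U + V) = halve U + halve V := by
    intro U V
    simp only [halve, Finsupp.mapDomain_add, ← smul_add]
    congr 1
    abel
  induction k with
  | zero =>
    intro w hk _ _
    have h0 : w = 0 := by simpa using hk
    exact ⟨0, by simp, by simp, by simp [halve, h0], by simp⟩
  | succ k ih =>
    intro w hk hw hch
    by_cases h0 : w = 0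
    · exact ⟨0, by simp, by simp, by simp [halve, h0], by simp⟩
    have hne : w.support.Nonempty := Finsupp.support_nonempty_iff.2 h0
    obtain ⟨a, ha, hamin⟩ : ∃ a ∈ w.support, ∀ p ∈ w.support, P.rel a p := by
      let := P.closureOrder
      obtain ⟨a, ha⟩ := w.support.exists_minimal hne
      refine ⟨a, ha.1, fun p hp => ?_⟩
      by_cases e : a = p
      · exact e ▸ P.refl a
      · rcases hch ha.1 hp e with h | h
        · exact h
        · exact absurd (P.acyclic _ _ (ha.2 hp (.single h)) (.single h)) e
    obtain ⟨b, hb, hbmax⟩ : ∃ b ∈ w.support, ∀ p ∈ w.support, P.rel p b := by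
      let := P.closureOrder
      obtain ⟨b, hb⟩ := w.support.exists_maximal hne
      refine ⟨b, hb.1, fun p hp => ?_⟩
      by_cases e : p = b
      · exact e ▸ P.refl p
      · rcases hch hp hb.1 e with h | h
        · exact h
        · exact absurd (P.acyclic _ _ (hb.2 hp (.single h)) (.single h)) e
    let J : P.Interval := ⟨a, b, hamin b hb⟩
    -- the amount of weight carried by `J`, before doubling
    obtain ⟨t, ht, w', hw', hw'0, hcard⟩ : ∃ t : ℝ, 0 ≤ t ∧ ∃ w' : P.carrier →₀ ℝ,
        w = w' + (Finsupp.single a t + Finsupp.single b t) ∧ (∀ p, 0 ≤ w' p) ∧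
        ∃ c ∈ w.support, w' c = 0 := by
      by_cases hab : a = b
      · subst hab
        refine ⟨w a / 2, by have := hw a; positivity,
          w - (Finsupp.single a (w a / 2) + Finsupp.single a (w a / 2)), by simp, ?_, a, ha, ?_⟩
        · intro p
          by_cases e : a = p
          · subst e; simp
          · simpa [Finsupp.single_apply, e] using hw p
        · simp
      · refine ⟨min (w a) (w b), le_min (hw a) (hw b),
          w - (Finsupp.single a (min (w a) (w b)) + Finsupp.single b (min (w a) (w b))),
          by simp, ?_, ?_⟩
        · intro p
          by_cases e : a = p
          · subst e; simp [Ne.symm hab]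
          · by_cases e' : b = p
            · subst e'; simp [hab]
            · simpa [Finsupp.single_apply, e, e'] using hw p
        · rcases le_total (w a) (w b) with h | h
          · exact ⟨a, ha, by simp [Ne.symm hab, h]⟩
          · exact ⟨b, hb, by simp [hab, h]⟩
    obtain ⟨c, hc, hc0⟩ := hcard
    have hsub : w'.support ⊆ w.support := by
      intro p hp
      have h1 : 0 < w' p := lt_of_le_of_ne (hw'0 p) (Ne.symm (Finsupp.mem_support_iff.1 hp))
      have h2 : 0 ≤ Finsupp.single a t p := by
        rw [Finsupp.single_apply]; split_ifs <;> simp [ht]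
      have h3 : 0 ≤ Finsupp.single b t p := by
        rw [Finsupp.single_apply]; split_ifs <;> simp [ht]
      rw [Finsupp.mem_support_iff, hw', Finsupp.add_apply, Finsupp.add_apply]
      positivity
    have hlt : w'.support.card < w.support.card := by
      refine Finset.card_lt_card (Finset.ssubset_iff_subset_ne.2 ⟨hsub, fun e => ?_⟩)
      rw [← e] at hc
      exact Finsupp.mem_support_iff.1 hc hc0
    obtain ⟨U, hU0, hUch, hUw, hUsupp⟩ := ih w' (by omega) hw'0
      (hch.mono (Finset.coe_subset.2 hsub))
    have hsupp : ∀ I ∈ (U + Finsupp.single J (2 * t)).support, I ∈ U.support ∨ I = J := by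
      intro I hI
      refine (Finset.mem_union.1 (Finsupp.support_add hI)).imp id fun h => ?_
      exact Finset.mem_singleton.1 (Finsupp.support_single_subset h)
    have hJ : ∀ I ∈ U.support, P.sharp.rel I J := by
      intro I hI
      have h1 := hUsupp I hI
      exact ⟨hamin _ (hsub h1.1), hbmax _ (hsub h1.2), hamin _ (hsub h1.2), hbmax _ (hsub h1.1)⟩
    refine ⟨U + Finsupp.single J (2 * t), ?_, ?_, ?_, ?_⟩
    · intro I
      have h2 : 0 ≤ Finsupp.single J (2 * t) I := by
        rw [Finsupp.single_apply]; split_ifs <;> simp [ht]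
      exact add_nonneg (hU0 I) h2
    · intro I hI K hK hIK
      rcases hsupp I hI with h1 | rfl <;> rcases hsupp K hK with h2 | rfl
      · exact hUch h1 h2 hIK
      · exact Or.inl (hJ I h1)
      · exact Or.inr (hJ K h2)
      · exact absurd rfl hIK
    · rw [hadd, hUw, hhalve, hw']
    · intro I hI
      rcases hsupp I hI with h1 | rfl
      · exact (hUsupp I h1).imp (fun h => hsub h) fun h => hsub h
      · exact ⟨ha, hb⟩

theorem canonicalBary_surjective (P : Preposet.{u}) : Function.Surjective P.canonicalBary := by
  intro w
  obtain ⟨U, hU0, hUch, hUw, -⟩ := P.exists_halve_eq _ w.weight le_rfl w.nonneg w.chain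
  refine ⟨⟨U, hU0, ?_, hUch⟩, Bary.ext hUw⟩
  have h := w.total
  rw [← hUw, ← mass_univ, mass_halve] at h
  simp only [Set.mem_univ, Set.ofPred_true, add_self_div_two] at h
  rw [← h]
  exact (mass_univ U).symm

/-- The canonical homeomorphism `h : |P^#| → |P|` (as a bijection): it sends the vertex `[σ, τ]`
to the midpoint of the segment between the vertices `σ` and `τ`, and is affine on the convex hull
of every chain of `P^#`. -/
noncomputable def canonical (P : Preposet.{u}) : P.sharp.Realization ≃ P.Realization :=
  (P.sharp.baryEquiv.symm.trans
    (Equiv.ofBijective P.canonicalBary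
      ⟨P.canonicalBary_injective, P.canonicalBary_surjective⟩)).trans P.baryEquiv

/-- The iterated canonical subdivision `P^{#m}`. -/
def sharpIter (P : Preposet.{u}) : ℕ → Preposet.{u}
  | 0 => P
  | m + 1 => (P.sharpIter m).sharp

/-- The iterated canonical homeomorphism `h_m : |P^{#m}| → |P|`. -/
noncomputable def canonicalIter (P : Preposet.{u}) :
    (m : ℕ) → (P.sharpIter m).Realization ≃ P.Realization
  | 0 => Equiv.refl _
  | m + 1 => (P.sharpIter m).canonical.trans (P.canonicalIter m)

end Preposet

/-- A poset is conditionally complete if every nonempty subset that has an upper bound has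
a least upper bound. -/
def IsConditionallyComplete (Q : Type u) [PartialOrder Q] : Prop :=
  ∀ S : Set Q, S.Nonempty → BddAbove S → ∃ a, IsLUB S a

/-! A point `y` of `|Q|` is determined by its levels: for `0 < t ≤ 1` there is a greatest `q` with
`t ≤ y q` (`exists_level`), and this `q` decreases as `t` grows. Sampling the levels at `2 ^ n`
values of `t` gives a decreasing sequence in `Q`, that is, an element of `Q^{#n}` which `h_n` sends
to the mean of the sequence (`exists_ofChain`). This mean is within `2 / 2 ^ n` of `y`, so `n`
depends on `ε` only.

The sampled sequences need not depend monotonically on the vertex. Comparison in `Q^{#n}` asks the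
entries of even index to increase and those of odd index to decrease. So at a vertex `v` of `P^{#m}`
the `i`-th entry is the supremum (`i` even) or infimum (`i` odd) of the `i`-th levels of `f (h_m u)`
over all `u ⪯ v`. As `v` grows the set of such `u` grows, which gives monotonicity. Conditional
completeness provides the suprema and infima, because nearby points have interleaved levels: moving
a point by `η` shifts its levels by at most `η` in `t`. Sampling values spaced `2η` apart keep the
sequence decreasing after the corrections (`exists_hom_approx`).

The required closeness comes from `dist_canonicalIter_le`: each subdivision halves distances along
chains, even chains of the transitive closure, so for large `m` the images of all `u ⪯ v` are close
together, and uniform continuity of `f` applies. On a simplex the estimate follows by averaging over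
vertices. -/

namespace Preposet

/-! ### The iterated canonical map on weights -/

/-- The effect of the iterated canonical map `|P^{#m}| → |P|` on weights. -/
noncomputable def iterHalve (P : Preposet.{u}) :
    (m : ℕ) → ((P.sharpIter m).carrier →₀ ℝ) → (P.carrier →₀ ℝ)
  | 0 => id
  | m + 1 => fun w => P.iterHalve m (halve (P := P.sharpIter m) w)

theorem baryEquiv_apply_coe {P : Preposet.{u}} (w : P.Bary) :
    (P.baryEquiv w : lp (fun _ : P => ℝ) ∞) = w.point := rfl

theorem canonicalIter_weight (P : Preposet.{u}) (m : ℕ) (w : (P.sharpIter m).Bary) :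
    (P.baryEquiv.symm (P.canonicalIter m ((P.sharpIter m).baryEquiv w))).weight =
      P.iterHalve m w.weight := by
  induction m with
  | zero =>
    exact congrArg Bary.weight (P.baryEquiv.symm_apply_apply w)
  | succ m ih =>
    refine Eq.trans ?_ (ih ((P.sharpIter m).canonicalBary w))
    exact congrArg (fun z => (P.baryEquiv.symm (P.canonicalIter m ((P.sharpIter m).baryEquiv
      ((P.sharpIter m).canonicalBary z)))).weight)
      ((P.sharpIter m).sharp.baryEquiv.symm_apply_apply w)

/-- Coordinates are masses of upper sets, so sup-metric estimates become estimates on masses. -/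
theorem realization_apply {P : Preposet.{u}} (x : P.Realization) (q : P) :
    (x : lp (fun _ : P => ℝ) ∞) q =
      mass {p | Relation.TransGen P.rel q p} (P.baryEquiv.symm x).weight := by
  rw [← Bary.point_apply, ← baryEquiv_apply_coe, Equiv.apply_symm_apply]

theorem halve_single {P : Preposet.{u}} (I : P.Interval) :
    halve (Finsupp.single I 1) =
      (1 / 2 : ℝ) • (Finsupp.single I.left 1 + Finsupp.single I.right 1) := by
  rw [halve, Finsupp.mapDomain_single, Finsupp.mapDomain_single]

theorem halve_add {P : Preposet.{u}} (w w' : P.Interval →₀ ℝ) :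
    halve (w + w') = halve w + halve w' := by
  simp only [halve, Finsupp.mapDomain_add, ← smul_add]
  congr 1
  abel

theorem halve_smul {P : Preposet.{u}} (t : ℝ) (w : P.Interval →₀ ℝ) :
    halve (t • w) = t • halve w := by
  simp only [halve, Finsupp.mapDomain_smul, ← smul_add]
  rw [smul_comm]

theorem iterHalve_add (P : Preposet.{u}) (m : ℕ) (w w' : (P.sharpIter m).carrier →₀ ℝ) :
    P.iterHalve m (w + w') = P.iterHalve m w + P.iterHalve m w' := by
  induction m with
  | zero => rfl
  | succ m ih => exact (congrArg _ (halve_add w w')).trans (ih _ _)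

theorem iterHalve_smul (P : Preposet.{u}) (m : ℕ) (t : ℝ)
    (w : (P.sharpIter m).carrier →₀ ℝ) :
    P.iterHalve m (t • w) = t • P.iterHalve m w := by
  induction m with
  | zero => rfl
  | succ m ih => exact (congrArg _ (halve_smul t w)).trans (ih _)

/-- `iterHalve` as a linear map. -/
noncomputable def iterHalveLinear (P : Preposet.{u}) (m : ℕ) :
    ((P.sharpIter m).carrier →₀ ℝ) →ₗ[ℝ] (P.carrier →₀ ℝ) where
  toFun := P.iterHalve m
  map_add' := P.iterHalve_add m
  map_smul' := P.iterHalve_smul m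

/-! ### Contraction of the canonical maps -/

theorem exists_of_mem_support_halve {P : Preposet.{u}} {w : P.Interval →₀ ℝ} {p : P.carrier}
    (hp : p ∈ (halve w).support) : ∃ I ∈ w.support, p = I.left ∨ p = I.right := by
  classical
  rcases Finset.mem_union.1 (Finsupp.support_add (Finsupp.support_smul hp)) with h | h
  · obtain ⟨I, hI, rfl⟩ := Finset.mem_image.1 (Finsupp.mapDomain_support h)
    exact ⟨I, hI, Or.inl rfl⟩
  · obtain ⟨I, hI, rfl⟩ := Finset.mem_image.1 (Finsupp.mapDomain_support h)
    exact ⟨I, hI, Or.inr rfl⟩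

theorem transGen_sharp {P : Preposet.{u}} {I J : P.Interval}
    (h : Relation.TransGen P.sharp.rel I J) :
    Relation.TransGen P.rel J.left I.left ∧ Relation.TransGen P.rel I.right J.right := by
  induction h with
  | single h => exact ⟨.single h.1, .single h.2.1⟩
  | tail _ h ih => exact ⟨.head h.1 ih.1, ih.2.tail h.2.1⟩

theorem mem_of_transGen {P : Preposet.{u}} {S : Set P} (hS : ∀ p q, P.rel p q → p ∈ S → q ∈ S)
    {p q : P} (h : Relation.TransGen P.rel p q) (hp : p ∈ S) : q ∈ S := by
  induction h with
  | single h => exact hS _ _ h hp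
  | tail _ h ih => exact hS _ _ h ih

theorem mass_add_mass_compl {α : Type u} (S : Set α) (w : α →₀ ℝ) :
    mass S w + mass Sᶜ w = mass Set.univ w := by
  rw [mass_eq_sum, mass_eq_sum, mass_eq_sum, ← Finset.sum_add_distrib]
  refine Finset.sum_congr rfl fun p _ => ?_
  by_cases h : p ∈ S <;> simp [h]

theorem mass_eq_zero {α : Type u} (S : Set α) (w : α →₀ ℝ) (h : ∀ p ∈ w.support, p ∉ S) :
    mass S w = 0 := by
  rw [mass_eq_sum]
  exact Finset.sum_eq_zero fun p hp => by rw [Set.indicator_of_notMem (h p hp), mul_zero]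

theorem mass_univ_halve {P : Preposet.{u}} (w : P.Interval →₀ ℝ) :
    mass Set.univ (halve w) = mass Set.univ w := by
  rw [mass_halve]
  simp

/-- Passing to the subdivided preposet halves the difference of the masses of upper sets, for
weights supported on a common chain of the transitive closure. -/
theorem abs_mass_halve_sub_le {P : Preposet.{u}} {w w' : P.Interval →₀ ℝ} {C : Set P.Interval}
    (hC : ∀ I ∈ C, ∀ J ∈ C, Relation.TransGen P.sharp.rel I J ∨ Relation.TransGen P.sharp.rel J I)
    (hw : ∀ I ∈ w.support, I ∈ C) (hw' : ∀ I ∈ w'.support, I ∈ C)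
    (htot : mass Set.univ w = mass Set.univ w') {d : ℝ}
    (hd : ∀ U : Set P.Interval, (∀ I J, P.sharp.rel I J → I ∈ U → J ∈ U) →
      |mass U w - mass U w'| ≤ d)
    {S : Set P} (hS : ∀ p q, P.rel p q → p ∈ S → q ∈ S) :
    |mass S (halve w) - mass S (halve w')| ≤ d / 2 := by
  rw [mass_halve, mass_halve]
  -- The intervals in `C` are nested, so one left end in `S` forces every right end into `S`. Hence
  -- at most one of the two summands of `mass_halve` distinguishes `w` from `w'`, and the factor `1
  -- / 2` survives.
  by_cases h : ∃ I ∈ C, I.left ∈ S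
  · obtain ⟨I, hI, hIS⟩ := h
    have hr : ∀ J ∈ C, J.right ∈ S := by
      intro J hJ
      rcases hC I hI J hJ with h | h
      · exact mem_of_transGen hS (transGen_sharp h).2 (hS _ _ I.le hIS)
      · exact hS _ _ J.le (mem_of_transGen hS (transGen_sharp h).1 hIS)
    have h1 : mass {J : P.Interval | J.right ∈ S} w = mass Set.univ w :=
      mass_congr _ _ _ fun J hJ => by simp [hr J (hw J hJ)]
    have h2 : mass {J : P.Interval | J.right ∈ S} w' = mass Set.univ w' :=
      mass_congr _ _ _ fun J hJ => by simp [hr J (hw' J hJ)]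
    have h3 := mass_add_mass_compl {J : P.Interval | J.left ∈ S} w
    have h4 := mass_add_mass_compl {J : P.Interval | J.left ∈ S} w'
    -- Enlarging an interval lowers its left end, so it is the complement that is an upper set;
    -- equal totals transfer the bound.
    have h5 := hd {J : P.Interval | J.left ∈ S}ᶜ fun I J hIJ hI hJ => hI (hS _ _ hIJ.1 hJ)
    rw [h1, h2]
    rw [abs_le] at h5 ⊢
    constructor <;> linarith [h5.1, h5.2]
  · push Not at h
    have h1 := mass_eq_zero {J : P.Interval | J.left ∈ S} w fun J hJ => h J (hw J hJ)
    have h2 := mass_eq_zero {J : P.Interval | J.left ∈ S} w' fun J hJ => h J (hw' J hJ)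
    have h5 := hd {J : P.Interval | J.right ∈ S} fun I J hIJ hI => hS _ _ hIJ.2.1 hI
    rw [h1, h2]
    rw [abs_le] at h5 ⊢
    constructor <;> linarith [h5.1, h5.2]

/-- One factor of two is gained per subdivision. The induction passes from `C` to the set of
endpoints of its intervals, whose elements are again pairwise comparable in the transitive closure.
-/
theorem abs_mass_iterHalve_sub_le (P : Preposet.{u}) (m : ℕ)
    {w w' : (P.sharpIter m).carrier →₀ ℝ} {C : Set (P.sharpIter m).carrier}
    (hC : ∀ I ∈ C, ∀ J ∈ C, Relation.TransGen (P.sharpIter m).rel I J ∨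
      Relation.TransGen (P.sharpIter m).rel J I)
    (hw : ∀ I ∈ w.support, I ∈ C) (hw' : ∀ I ∈ w'.support, I ∈ C)
    (htot : mass Set.univ w = mass Set.univ w') {d : ℝ}
    (hd : ∀ U : Set (P.sharpIter m).carrier,
      (∀ I J, (P.sharpIter m).rel I J → I ∈ U → J ∈ U) → |mass U w - mass U w'| ≤ d)
    {S : Set P} (hS : ∀ p q, P.rel p q → p ∈ S → q ∈ S) :
    |mass S (P.iterHalve m w) - mass S (P.iterHalve m w')| ≤ d / 2 ^ m := by
  induction m generalizing d with
  | zero =>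
    rw [pow_zero, div_one]
    exact hd S hS
  | succ m ih =>
    let A := P.sharpIter m
    have key := ih (w := halve (P := A) w) (w' := halve (P := A) w')
      (C := {p | ∃ I ∈ C, p = Interval.left I ∨ p = Interval.right I}) ?_ ?_ ?_ ?_
      (fun U hU => abs_mass_halve_sub_le (P := A) hC hw hw' htot hd hU)
    · rw [div_div, ← pow_succ'] at key
      exact key
    · rintro p ⟨I, hI, hp⟩ q ⟨J, hJ, hq⟩
      have hl := Relation.TransGen.single (Interval.le I)
      have hr := Relation.TransGen.single (Interval.le J)
      rcases hC I hI J hJ with h | h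
      · obtain ⟨h1, h2⟩ := transGen_sharp h
        rcases hp with rfl | rfl <;> rcases hq with rfl | rfl
        · exact Or.inr h1
        · exact Or.inl (hl.trans h2)
        · exact Or.inr (h1.trans hl)
        · exact Or.inl h2
      · obtain ⟨h1, h2⟩ := transGen_sharp h
        rcases hp with rfl | rfl <;> rcases hq with rfl | rfl
        · exact Or.inl h1
        · exact Or.inl (h1.trans hr)
        · exact Or.inr (hr.trans h2)
        · exact Or.inr h2
    · intro p hp
      obtain ⟨I, hI, h⟩ := exists_of_mem_support_halve hp
      exact ⟨I, hw I hI, h⟩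
    · intro p hp
      obtain ⟨I, hI, h⟩ := exists_of_mem_support_halve hp
      exact ⟨I, hw' I hI, h⟩
    · exact (mass_univ_halve (P := A) w).trans (htot.trans (mass_univ_halve (P := A) w').symm)

/-! ### Distances in the realization and small simplices -/

theorem Bary.mass_univ_eq_one {P : Preposet.{u}} (w : P.Bary) : mass Set.univ w.weight = 1 := by
  rw [mass_univ, w.total]

theorem Bary.mass_le_one {P : Preposet.{u}} (w : P.Bary) (S : Set P) : mass S w.weight ≤ 1 :=
  (mass_mono S Set.univ w.weight w.nonneg fun _ _ _ => trivial).trans_eq w.mass_univ_eq_one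

theorem realization_dist_le {P : Preposet.{u}} {x y : P.Realization} {d : ℝ} (hd : 0 ≤ d)
    (h : ∀ q, |(x : lp (fun _ : P => ℝ) ∞) q - (y : lp (fun _ : P => ℝ) ∞) q| ≤ d) :
    dist x y ≤ d := by
  rw [Subtype.dist_eq, dist_eq_norm]
  exact lp.norm_le_of_forall_le hd h

theorem realization_abs_sub_le_dist {P : Preposet.{u}} (x y : P.Realization) (q : P) :
    |(x : lp (fun _ : P => ℝ) ∞) q - (y : lp (fun _ : P => ℝ) ∞) q| ≤ dist x y := by
  rw [Subtype.dist_eq, dist_eq_norm]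
  exact lp.norm_apply_le_norm ENNReal.top_ne_zero
    ((x : lp (fun _ : P => ℝ) ∞) - (y : lp (fun _ : P => ℝ) ∞)) q

/-- The iterated canonical map contracts every chain of the transitive closure by the
factor `2 ^ m`. -/
theorem dist_canonicalIter_le (P : Preposet.{u}) (m : ℕ) (w w' : (P.sharpIter m).Bary)
    {C : Set (P.sharpIter m).carrier}
    (hC : ∀ I ∈ C, ∀ J ∈ C, Relation.TransGen (P.sharpIter m).rel I J ∨
      Relation.TransGen (P.sharpIter m).rel J I)
    (hw : ∀ I ∈ w.weight.support, I ∈ C) (hw' : ∀ I ∈ w'.weight.support, I ∈ C) :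
    dist (P.canonicalIter m ((P.sharpIter m).baryEquiv w))
      (P.canonicalIter m ((P.sharpIter m).baryEquiv w')) ≤ 1 / 2 ^ m := by
  refine realization_dist_le (by positivity) fun q => ?_
  rw [realization_apply, realization_apply, canonicalIter_weight, canonicalIter_weight]
  -- The induction starts from the trivial bound 1 for the difference of two probabilities.
  refine P.abs_mass_iterHalve_sub_le m hC hw hw'
    (w.mass_univ_eq_one.trans w'.mass_univ_eq_one.symm) (fun U _ => ?_)
    fun p p' hp hq => Relation.TransGen.tail hq hp
  have h1 := w.mass_le_one U
  have h2 := w'.mass_le_one U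
  have h3 := mass_nonneg U w.weight w.nonneg
  have h4 := mass_nonneg U w'.weight w'.nonneg
  rw [abs_le]
  constructor <;> linarith

/-- The barycentric coordinates of a vertex. -/
noncomputable def Bary.pure {P : Preposet.{u}} (p : P) : P.Bary where
  weight := Finsupp.single p 1
  nonneg q := by
    classical
    rw [Finsupp.single_apply]
    split_ifs <;> simp
  total := by simp
  chain := by
    intro a ha b hb hab
    exact absurd ((Finset.mem_singleton.1 (Finsupp.support_single_subset ha)).trans
      (Finset.mem_singleton.1 (Finsupp.support_single_subset hb)).symm) hab

theorem Bary.mem_support_pure {P : Preposet.{u}} {p q : P}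
    (h : q ∈ (Bary.pure p).weight.support) : q = p :=
  Finset.mem_singleton.1 (Finsupp.support_single_subset h)

/-- Here `u` and `v` need not span a simplex; this is where chains of the transitive closure are
needed. -/
theorem dist_canonicalIter_pure_le (P : Preposet.{u}) (m : ℕ) {u v : (P.sharpIter m).carrier}
    (h : Relation.TransGen (P.sharpIter m).rel u v) :
    dist (P.canonicalIter m ((P.sharpIter m).baryEquiv (Bary.pure u)))
      (P.canonicalIter m ((P.sharpIter m).baryEquiv (Bary.pure v))) ≤ 1 / 2 ^ m := by
  refine P.dist_canonicalIter_le m _ _ (C := {u, v}) ?_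
    (fun I hI => Or.inl (Bary.mem_support_pure hI)) fun I hI => Or.inr (Bary.mem_support_pure hI)
  rintro I (rfl | rfl) J (rfl | rfl)
  · exact Or.inl (.single (Preposet.refl _ _))
  · exact Or.inl h
  · exact Or.inr h
  · exact Or.inl (.single (Preposet.refl _ _))

theorem dist_canonicalIter_pure_bary_le (P : Preposet.{u}) (m : ℕ) (w : (P.sharpIter m).Bary)
    {v : (P.sharpIter m).carrier} (hv : v ∈ w.weight.support) :
    dist (P.canonicalIter m ((P.sharpIter m).baryEquiv (Bary.pure v)))
      (P.canonicalIter m ((P.sharpIter m).baryEquiv w)) ≤ 1 / 2 ^ m := by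
  refine P.dist_canonicalIter_le m _ _ (C := w.weight.support) (fun I hI J hJ => ?_)
    (fun I hI => Bary.mem_support_pure hI ▸ hv) fun I hI => hI
  by_cases e : I = J
  · exact Or.inl (e ▸ .single (Preposet.refl _ _))
  · exact (w.chain hI hJ e).imp .single .single

/-! ### Elements of the iterated subdivision of a poset as finite chains -/

theorem sum_range_two_mul (N : ℕ) (φ : ℕ → ℝ) :
    ∑ i ∈ Finset.range (2 * N), φ i = ∑ i ∈ Finset.range N, (φ (2 * i) + φ (2 * i + 1)) := by
  induction N with
  | zero => simp
  | succ N ih => rw [Nat.mul_succ, Finset.sum_range_succ, Finset.sum_range_succ, ih,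
      Finset.sum_range_succ, add_assoc]

/-- Every decreasing sequence of `2 ^ n` elements of `Q` yields an element of `Q^{#n}` that
`h_n` sends to their mean; in terms of sequences, the relation of `Q^{#n}` is given by the
relation of `Q` with alternating directions. -/
theorem exists_ofChain (Q : Type v) [PartialOrder Q] (n : ℕ) :
    ∃ E : {x : ℕ → Q // ∀ i j, i ≤ j → j < 2 ^ n → x j ≤ x i} → ((ofPoset Q).sharpIter n).carrier,
      (∀ x y, (∀ i < 2 ^ n, (Even i → x.1 i ≤ y.1 i) ∧ (¬ Even i → y.1 i ≤ x.1 i)) →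
        ((ofPoset Q).sharpIter n).rel (E x) (E y)) ∧
      ∀ x (S : Set Q), mass S ((ofPoset Q).iterHalve n (Finsupp.single (E x) 1)) =
        (∑ i ∈ Finset.range (2 ^ n), S.indicator 1 (x.1 i)) / 2 ^ n := by
  induction n with
  | zero =>
    refine ⟨fun x => x.1 0, fun x y h => (h 0 (by simp)).1 (by simp), fun x S => ?_⟩
    change mass S (Finsupp.single (x.1 0) 1) = _
    simp [mass]
  | succ n ih =>
    obtain ⟨E, hE, hm⟩ := ih
    have hp : 2 ^ (n + 1) = 2 * 2 ^ n := pow_succ' 2 n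
    -- The sequence is cut into pairs `2 * i, 2 * i + 1`; `a` selects the left end of the interval
    -- and `b` the right end. The choice alternates with `i` so that left precedes right in the
    -- alternating order. Also `a` flips parity and `b` keeps it, matching the reversed comparison
    -- of left ends under inclusion.
    let a : ℕ → ℕ := fun i => if Even i then 2 * i + 1 else 2 * i
    let b : ℕ → ℕ := fun i => if Even i then 2 * i else 2 * i + 1
    have ha : ∀ i, 2 * i ≤ a i ∧ a i ≤ 2 * i + 1 := fun i => by
      dsimp only [a]; split_ifs <;> omega
    have hb : ∀ i, 2 * i ≤ b i ∧ b i ≤ 2 * i + 1 := fun i => by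
      dsimp only [b]; split_ifs <;> omega
    have ha' : ∀ i, Even (a i) ↔ ¬ Even i := fun i => by
      dsimp only [a]; split_ifs with h <;> simp [h, parity_simps]
    have hb' : ∀ i, Even (b i) ↔ Even i := fun i => by
      dsimp only [b]; split_ifs with h <;> simp [h, parity_simps]
    have hmono : ∀ c : ℕ → ℕ, (∀ i, 2 * i ≤ c i ∧ c i ≤ 2 * i + 1) → ∀ i j, i ≤ j → c i ≤ c j := by
      intro c hc i j hij
      rcases hij.eq_or_lt with rfl | h
      · exact le_rfl
      · have := hc i; have := hc j; omega
    let sub : (c : ℕ → ℕ) → (∀ i, 2 * i ≤ c i ∧ c i ≤ 2 * i + 1) →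
        {x : ℕ → Q // ∀ i j, i ≤ j → j < 2 ^ (n + 1) → x j ≤ x i} →
        {x : ℕ → Q // ∀ i j, i ≤ j → j < 2 ^ n → x j ≤ x i} := fun c hc x =>
      ⟨fun i => x.1 (c i), fun i j hij hj => x.2 _ _ (hmono c hc i j hij)
        (by have := hc j; omega)⟩
    have hab : ∀ x, ∀ i < 2 ^ n, (Even i → (sub a ha x).1 i ≤ (sub b hb x).1 i) ∧
        (¬ Even i → (sub b hb x).1 i ≤ (sub a ha x).1 i) := by
      intro x i hi
      refine ⟨fun h => x.2 _ _ ?_ ?_, fun h => x.2 _ _ ?_ ?_⟩ <;>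
        simp only [a, b, h, if_true, if_false] <;> omega
    refine ⟨fun x => ⟨E (sub a ha x), E (sub b hb x), hE _ _ (hab x)⟩, ?_, ?_⟩
    · intro x y h
      have h1 : ∀ i < 2 ^ n, (Even i → (sub a ha y).1 i ≤ (sub a ha x).1 i) ∧
          (¬ Even i → (sub a ha x).1 i ≤ (sub a ha y).1 i) := by
        intro i hi
        have := h (a i) (by have := ha i; omega)
        rw [ha', not_not] at this
        exact this.symm
      have h2 : ∀ i < 2 ^ n, (Even i → (sub b hb x).1 i ≤ (sub b hb y).1 i) ∧
          (¬ Even i → (sub b hb y).1 i ≤ (sub b hb x).1 i) := by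
        intro i hi
        have := h (b i) (by have := hb i; omega)
        rwa [hb'] at this
      refine ⟨hE _ _ h1, hE _ _ h2, hE _ _ fun i hi => ?_, hE _ _ fun i hi => ?_⟩
      · exact ⟨fun e => ((h1 i hi).1 e).trans ((hab x i hi).1 e),
          fun e => ((hab x i hi).2 e).trans ((h1 i hi).2 e)⟩
      · exact ⟨fun e => ((hab x i hi).1 e).trans ((h2 i hi).1 e),
          fun e => ((h2 i hi).2 e).trans ((hab x i hi).2 e)⟩
    · intro x S
      change mass S ((ofPoset Q).iterHalve n (halve (P := (ofPoset Q).sharpIter n)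
        (Finsupp.single _ 1))) = _
      rw [halve_single, iterHalve_smul, iterHalve_add, map_smul, map_add, hm, hm,
        show Finset.range (2 ^ (n + 1)) = Finset.range (2 * 2 ^ n) by rw [hp],
        sum_range_two_mul, ← add_div, ← Finset.sum_add_distrib, smul_eq_mul,
        div_mul_div_comm, one_mul, show (2 : ℝ) ^ (n + 1) = 2 * 2 ^ n from pow_succ' 2 n]
      congr 1
      refine Finset.sum_congr rfl fun i _ => ?_
      dsimp only [sub, a, b]
      split_ifs
      · exact add_comm _ _
      · rfl

/-! ### Points of the realization of a poset as step functions -/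

/-- The support is a finite chain, and `c` is its largest element whose upper mass is at least `t`.
Such an element exists since `t ≤ 1` admits the least element of the support. -/
theorem Bary.exists_isGreatest {Q : Type v} [PartialOrder Q] (w : (ofPoset Q).Bary) {t : ℝ}
    (ht : 0 < t) (ht1 : t ≤ 1) : ∃ c : Q, ∀ q : Q, q ≤ c ↔ t ≤ mass (Set.Ici q) w.weight := by
  classical
  have hcmp : ∀ p ∈ w.weight.support, ∀ q ∈ w.weight.support, (p : Q) ≤ q ∨ (q : Q) ≤ p := by
    intro p hp q hq
    by_cases e : p = q
    · exact Or.inl (le_of_eq e)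
    · exact w.chain hp hq e
  -- Any `q` of positive upper mass can be replaced by the least support element above it; `0 < t`
  -- makes this applicable below.
  have hlow : ∀ q : Q, 0 < mass (Set.Ici q) w.weight →
      ∃ p ∈ w.weight.support, q ≤ p ∧ mass (Set.Ici p) w.weight = mass (Set.Ici q) w.weight := by
    intro q hq
    have hne : (w.weight.support.filter fun p : Q => q ≤ p).Nonempty := by
      by_contra h
      rw [Finset.not_nonempty_iff_eq_empty, Finset.filter_eq_empty_iff] at h
      exact hq.ne' (mass_eq_zero _ _ fun p hp => h hp)
    obtain ⟨p, hp⟩ := Finset.exists_minimal (α := Q) hne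
    have hp1 := Finset.mem_filter.1 hp.1
    refine ⟨p, hp1.1, hp1.2, mass_congr _ _ _ fun r hr => ⟨fun h => hp1.2.trans h, fun h => ?_⟩⟩
    rcases hcmp p hp1.1 r hr with h' | h'
    · exact h'
    · exact hp.2 (Finset.mem_filter.2 ⟨hr, h⟩) h'
  have hne : (w.weight.support.filter fun p : Q => t ≤ mass (Set.Ici p) w.weight).Nonempty := by
    have hs : w.weight.support.Nonempty := by
      rw [Finsupp.support_nonempty_iff]
      intro h
      simpa [h] using w.total
    obtain ⟨a, ha⟩ := Finset.exists_minimal (α := Q) hs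
    refine ⟨a, Finset.mem_filter.2 ⟨ha.1, ?_⟩⟩
    rw [mass_congr (Set.Ici a) Set.univ w.weight fun p hp => ?_]
    · exact ht1.trans_eq w.mass_univ_eq_one.symm
    · refine ⟨fun _ => trivial, fun _ => ?_⟩
      rcases hcmp a ha.1 p hp with h | h
      · exact h
      · exact ha.2 hp h
  obtain ⟨c, hc⟩ := Finset.exists_maximal (α := Q) hne
  have hc1 := Finset.mem_filter.1 hc.1
  refine ⟨c, fun q => ⟨fun h => hc1.2.trans ?_, fun h => ?_⟩⟩
  · exact mass_mono _ _ _ w.nonneg fun p _ hp => h.trans hp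
  · obtain ⟨p, hp, hqp, he⟩ := hlow q (ht.trans_le h)
    refine hqp.trans ?_
    rcases hcmp p hp c hc1.1 with h' | h'
    · exact h'
    · exact hc.2 (Finset.mem_filter.2 ⟨hp, h.trans_eq he.symm⟩) h'

theorem poset_apply {Q : Type v} [PartialOrder Q] (y : (ofPoset Q).Realization) (q : Q) :
    (y : lp (fun _ : Q => ℝ) ∞) q =
      mass (Set.Ici q) ((ofPoset Q).baryEquiv.symm y).weight := by
  refine (realization_apply y q).trans (mass_congr _ _ _ fun p _ => ?_)
  exact iff_of_eq (congrFun (congrFun (Relation.transGen_eq_self (r := fun p q : Q => p ≤ q)) q) p)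

theorem exists_level {Q : Type v} [PartialOrder Q] (y : (ofPoset Q).Realization) {t : ℝ}
    (ht : 0 < t) (ht1 : t ≤ 1) :
    ∃ c : Q, ∀ q : Q, q ≤ c ↔ t ≤ (y : lp (fun _ : Q => ℝ) ∞) q := by
  simp only [poset_apply]
  exact Bary.exists_isGreatest _ ht ht1

theorem poset_apply_nonneg {Q : Type v} [PartialOrder Q] (y : (ofPoset Q).Realization) (q : Q) :
    0 ≤ (y : lp (fun _ : Q => ℝ) ∞) q := by
  rw [poset_apply]
  exact mass_nonneg _ _ ((ofPoset Q).baryEquiv.symm y).nonneg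

theorem poset_apply_le_one {Q : Type v} [PartialOrder Q] (y : (ofPoset Q).Realization) (q : Q) :
    (y : lp (fun _ : Q => ℝ) ∞) q ≤ 1 := by
  rw [poset_apply]
  exact ((ofPoset Q).baryEquiv.symm y).mass_le_one _

/-- The indices counted include all those below `⌊Y⌋ - 1` and lie below `⌊Y⌋ + 2`. -/
theorem abs_sum_indicator_sub_le {α : Type v} (S : Set α) (x : ℕ → α) (N : ℕ) (Y : ℝ) (h0 : 0 ≤ Y)
    (h1 : Y ≤ N) (hlow : ∀ i < N, (i : ℝ) + 2 ≤ Y → x i ∈ S)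
    (hup : ∀ i < N, x i ∈ S → (i : ℝ) ≤ Y + 1) :
    |∑ i ∈ Finset.range N, S.indicator (1 : α → ℝ) (x i) - Y| ≤ 2 := by
  classical
  have hs : ∑ i ∈ Finset.range N, S.indicator (1 : α → ℝ) (x i) =
      (((Finset.range N).filter fun i => x i ∈ S).card : ℝ) := by
    simp [Set.indicator_apply]
  have hf := Nat.floor_le h0
  have hf' := Nat.lt_floor_add_one Y
  have hfN : ⌊Y⌋₊ ≤ N := by exact_mod_cast hf.trans h1
  have hsub1 : Finset.range (⌊Y⌋₊ - 1) ⊆ (Finset.range N).filter fun i => x i ∈ S := by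
    intro i hi
    rw [Finset.mem_range] at hi
    refine Finset.mem_filter.2 ⟨Finset.mem_range.2 (by omega), hlow i (by omega) ?_⟩
    have : i + 2 ≤ ⌊Y⌋₊ := by omega
    exact le_trans (by exact_mod_cast this) hf
  have hsub2 : ((Finset.range N).filter fun i => x i ∈ S) ⊆ Finset.range (⌊Y⌋₊ + 2) := by
    intro i hi
    obtain ⟨hi, hx⟩ := Finset.mem_filter.1 hi
    have h2 := hup i (Finset.mem_range.1 hi) hx
    rw [Finset.mem_range]
    have : (i : ℝ) < (⌊Y⌋₊ + 2 : ℕ) := by push_cast; linarith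
    exact_mod_cast this
  have c1 := Finset.card_le_card hsub1
  have c2 := Finset.card_le_card hsub2
  rw [Finset.card_range] at c1 c2
  rw [hs]
  have c1' : (⌊Y⌋₊ : ℝ) ≤ ((Finset.range N).filter fun i => x i ∈ S).card + 1 := by
    exact_mod_cast (show ⌊Y⌋₊ ≤ _ + 1 by omega)
  have c2' : (((Finset.range N).filter fun i => x i ∈ S).card : ℝ) ≤ ⌊Y⌋₊ + 2 := by
    exact_mod_cast c2
  rw [abs_le]
  constructor <;> linarith

end Preposet

/-! ### Monotone approximation in a conditionally complete poset -/

theorem IsConditionallyComplete.exists_isGLB {Q : Type u} [PartialOrder Q]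
    (hQ : IsConditionallyComplete Q) {S : Set Q} (hS : S.Nonempty) (hb : BddBelow S) :
    ∃ a, IsGLB S a := by
  obtain ⟨a, ha⟩ := hQ (lowerBounds S) hb hS.bddAbove_lowerBounds
  exact ⟨a, isLUB_lowerBounds.1 ha⟩

namespace Preposet

/-- Points `F v` of the realization of a conditionally complete poset which are sufficiently
close to each other along the transitive closure are approximated by a monotone map
to `Q^{#n}`. -/
theorem exists_hom_approx {K : Preposet.{u}} {Q : Type v} [PartialOrder Q]
    (hQ : IsConditionallyComplete Q) (n : ℕ) {η : ℝ} (hη : 2 * η * (2 ^ n + 1) = 1)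
    (F : K → (ofPoset Q).Realization)
    (hF : ∀ v u u', Relation.TransGen K.rel u v → Relation.TransGen K.rel u' v →
      dist (F u) (F u') ≤ η) :
    ∃ g : Hom K ((ofPoset Q).sharpIter n), ∀ v (y : (ofPoset Q).Realization),
      (∀ u, Relation.TransGen K.rel u v → dist (F u) y ≤ η) → ∀ q : Q,
      |mass (Set.Ici q) ((ofPoset Q).iterHalve n (Finsupp.single (g.toFun v) 1)) -
        (y : lp (fun _ : Q => ℝ) ∞) q| ≤ 2 / 2 ^ n := by
  have hN : (0 : ℝ) < 2 ^ n := by positivity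
  have hη0 : 0 < η := by
    by_contra h
    nlinarith
  have hlev : ∀ (v : K) (t : ℝ), ∃ c : Q, 0 < t → t ≤ 1 →
      ∀ q : Q, q ≤ c ↔ t ≤ (F v : lp (fun _ : Q => ℝ) ∞) q := by
    intro v t
    by_cases h : 0 < t ∧ t ≤ 1
    · obtain ⟨c, hc⟩ := exists_level (F v) h.1 h.2
      exact ⟨c, fun _ _ => hc⟩
    · obtain ⟨c, -⟩ := exists_level (F v) one_pos le_rfl
      exact ⟨c, fun h1 h2 => absurd ⟨h1, h2⟩ h⟩
  choose c hc using hlev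
  have hanti : ∀ v s t, 0 < t → t ≤ s → s ≤ 1 → c v s ≤ c v t := fun v s t h0 h h1 =>
    (hc v t h0 (h.trans h1) _).2 (h.trans ((hc v s (h0.trans_le h) h1 _).1 le_rfl))
  -- Interleaving: values within `η` of each other have levels comparable after a shift of `t` by
  -- `η`.
  have hstep : ∀ v u u' s t, Relation.TransGen K.rel u v → Relation.TransGen K.rel u' v →
      0 < t → t + η ≤ s → s ≤ 1 → c u s ≤ c u' t := by
    intro v u u' s t hu hu' h0 h h1
    rw [hc u' t h0 (by linarith)]
    have h2 := (hc u s (by linarith) h1 _).1 le_rfl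
    have h3 := (realization_abs_sub_le_dist (F u) (F u') (c u s)).trans (hF v u u' hu hu')
    linarith [(abs_le.1 h3).2]
  -- The windows `[t i - η, t i + η]` for `i < 2 ^ n` meet at most in endpoints and lie in `(0, 1]`;
  -- this dictates the normalization `hη`.
  let t : ℕ → ℝ := fun i => 2 * η * (i + 1)
  have ht0 : ∀ i, η < t i := fun i => by
    have : (0 : ℝ) ≤ η * i := by positivity
    dsimp only [t]
    linarith
  have ht1 : ∀ i < 2 ^ n, t i + η ≤ 1 := fun i hi => by
    have h1 : (i : ℝ) + 1 ≤ 2 ^ n := by exact_mod_cast hi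
    have h2 := mul_le_mul_of_nonneg_left h1 hη0.le
    dsimp only [t]
    linarith
  have htt : ∀ i j, i < j → t i + η ≤ t j - η := fun i j hij => by
    have h1 : (i : ℝ) + 1 ≤ j := by exact_mod_cast hij
    have h2 := mul_le_mul_of_nonneg_left h1 hη0.le
    dsimp only [t]
    linarith
  let A : ℕ → K → Set Q := fun i v => {a | ∃ u, Relation.TransGen K.rel u v ∧ a = c u (t i)}
  have hself : ∀ v, Relation.TransGen K.rel v v := fun v => .single (K.refl v)
  have hAne : ∀ i v, (A i v).Nonempty := fun i v => ⟨_, v, hself v, rfl⟩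
  have hAup : ∀ i < 2 ^ n, ∀ v, c v (t i - η) ∈ upperBounds (A i v) := by
    rintro i hi v _ ⟨u, hu, rfl⟩
    exact hstep v u v _ _ hu (hself v) (by linarith [ht0 i]) (by linarith) (by linarith [ht1 i hi])
  have hAlow : ∀ i < 2 ^ n, ∀ v, c v (t i + η) ∈ lowerBounds (A i v) := by
    rintro i hi v _ ⟨u, hu, rfl⟩
    exact hstep v v u _ _ (hself v) hu (by linarith [ht0 i]) (by linarith) (ht1 i hi)
  have hex : ∀ i v, ∃ a : Q, i < 2 ^ n →
      (Even i → IsLUB (A i v) a) ∧ (¬ Even i → IsGLB (A i v) a) := by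
    intro i v
    by_cases hi : i < 2 ^ n
    · by_cases he : Even i
      · obtain ⟨a, ha⟩ := hQ (A i v) (hAne i v) ⟨_, hAup i hi v⟩
        exact ⟨a, fun _ => ⟨fun _ => ha, fun h => absurd he h⟩⟩
      · obtain ⟨a, ha⟩ := hQ.exists_isGLB (hAne i v) ⟨_, hAlow i hi v⟩
        exact ⟨a, fun _ => ⟨fun h => absurd h he, fun _ => ha⟩⟩
    · exact ⟨c v 1, fun h => absurd h hi⟩
  choose G hG using hex
  have hGup : ∀ i < 2 ^ n, ∀ v, G i v ≤ c v (t i - η) := by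
    intro i hi v
    by_cases he : Even i
    · exact ((hG i v hi).1 he).2 (hAup i hi v)
    · exact (((hG i v hi).2 he).1 ⟨v, hself v, rfl⟩).trans
        (hAup i hi v ⟨v, hself v, rfl⟩)
  have hGlow : ∀ i < 2 ^ n, ∀ v b, b ∈ lowerBounds (A i v) → b ≤ G i v := by
    intro i hi v b hb
    by_cases he : Even i
    · exact (hb ⟨v, hself v, rfl⟩).trans (((hG i v hi).1 he).1 ⟨v, hself v, rfl⟩)
    · exact ((hG i v hi).2 he).2 hb
  have hGanti : ∀ v, ∀ i j, i ≤ j → j < 2 ^ n → G j v ≤ G i v := by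
    intro v i j hij hj
    rcases hij.eq_or_lt with rfl | h
    · exact le_rfl
    · have hi := h.trans hj
      -- Each entry is trapped between the levels of `F v` at the two ends of its window, and the
      -- window of `j` lies above that of `i`.
      refine (hGup j hj v).trans (le_trans ?_ (hGlow i hi v _ (hAlow i hi v)))
      exact hanti v _ _ (by linarith [ht0 i]) (htt i j h) (by linarith [ht1 j hj])
  obtain ⟨E, hE, hm⟩ := exists_ofChain Q n
  refine ⟨⟨fun v => E ⟨fun i => G i v, hGanti v⟩, fun v v' hv => hE _ _ fun i hi => ?_⟩, ?_⟩
  -- More predecessors raise suprema and lower infima, exactly the alternating order.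
  · have hsub : A i v ⊆ A i v' := fun a ⟨u, hu, ha⟩ => ⟨u, hu.tail hv, ha⟩
    exact ⟨fun he => ((hG i v hi).1 he).mono ((hG i v' hi).1 he) hsub,
      fun he => ((hG i v hi).2 he).mono ((hG i v' hi).2 he) hsub⟩
  · intro v y hy q
    have hy0 := poset_apply_nonneg y q
    have hy1 := poset_apply_le_one y q
    have hclose : ∀ u, Relation.TransGen K.rel u v → |(F u : lp (fun _ : Q => ℝ) ∞) q -
        (y : lp (fun _ : Q => ℝ) ∞) q| ≤ η := fun u hu =>
      (realization_abs_sub_le_dist (F u) y q).trans (hy u hu)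
    set Y := (y : lp (fun _ : Q => ℝ) ∞) q
    have key := abs_sum_indicator_sub_le (Set.Ici q) (fun i => G i v) (2 ^ n) (2 ^ n * Y)
      (by positivity) (by push_cast; nlinarith) ?_ ?_
    · rw [hm, div_sub' hN.ne', abs_div, abs_of_pos hN]
      gcongr
    · intro i hi h
      refine hGlow i hi v q ?_
      rintro _ ⟨u, hu, rfl⟩
      rw [hc u (t i) (hη0.trans (ht0 i)) (by linarith [ht1 i hi])]
      have h1 := (abs_le.1 (hclose u hu)).1
      have h2 := mul_le_mul_of_nonneg_left h hη0.le
      -- By `hη`, the index scale `2 ^ n * Y` and the level scale `Y / (2 * η)` differ by exactly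
      -- `Y`, which is at most 1.
      have h3 : 2 * (η * (2 ^ n * Y)) = Y - 2 * (η * Y) := by linear_combination Y * hη
      have h4 : 0 ≤ η * Y := by positivity
      dsimp only [t]
      linarith
    · intro i hi h
      have h1 := (hc v (t i - η) (by linarith [ht0 i]) (by linarith [ht1 i hi]) q).1
        (le_trans h (hGup i hi v))
      have h2 := (abs_le.1 (hclose v (hself v))).2
      have h3 : 2 * (η * (2 ^ n * Y)) = Y - 2 * (η * Y) := by linear_combination Y * hη
      have h4 : η * Y ≤ η * 1 := mul_le_mul_of_nonneg_left hy1 hη0.le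
      refine le_of_mul_le_mul_left ?_ hη0
      dsimp only [t] at h1
      linarith

/-- The value at `q` of the point of `|Q|` obtained from a monotone map into `Q^{#n}` is the
weighted mean of the values at the vertices. -/
theorem canonicalIter_realize_apply {K : Preposet.{u}} {Q : Type v} [PartialOrder Q] (n : ℕ)
    (g : Hom K ((ofPoset Q).sharpIter n)) (w : K.Bary) (q : Q) :
    ((ofPoset Q).canonicalIter n (g.realize (K.baryEquiv w)) : lp (fun _ : Q => ℝ) ∞) q =
      ∑ v ∈ w.weight.support, w.weight v *
        mass (Set.Ici q) ((ofPoset Q).iterHalve n (Finsupp.single (g.toFun v) 1)) := by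
  rw [poset_apply, Hom.realize, Equiv.symm_apply_apply, canonicalIter_weight]
  change ((mass (Set.Ici q)).comp ((ofPoset Q).iterHalveLinear n))
    (w.weight.mapDomain g.toFun) = _
  rw [Finsupp.mapDomain, Finsupp.sum, map_sum]
  refine Finset.sum_congr rfl fun v _ => ?_
  rw [← mul_one (w.weight v), ← smul_eq_mul (w.weight v) 1, ← Finsupp.smul_single, map_smul,
    smul_eq_mul, smul_eq_mul, mul_one]
  rfl

end Preposet

/-! ### Choice of constants and averaging over a simplex -/

theorem mainTheorem12 (ε : ℝ) (hε : 0 < ε) :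
    ∃ n : ℕ, ∀ (P : Preposet.{u}) (Q : Type v) [PartialOrder Q], IsConditionallyComplete Q →
      ∀ f : P.Realization → (Preposet.ofPoset Q).Realization, UniformContinuous f →
        ∃ M : ℕ, ∀ m : ℕ, M ≤ m →
          ∃ g : Preposet.Hom (P.sharpIter m) ((Preposet.ofPoset Q).sharpIter n),
            ∀ x : P.Realization,
              dist ((Preposet.ofPoset Q).canonicalIter n
                (g.realize ((P.canonicalIter m).symm x))) (f x) < ε := by
  have hpow : ∀ r : ℝ, 0 < r → ∃ n : ℕ, 2 / 2 ^ n < r := by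
    intro r hr
    obtain ⟨n, hn⟩ := pow_unbounded_of_one_lt (2 / r) (one_lt_two (α := ℝ))
    refine ⟨n, ?_⟩
    rw [div_lt_iff₀ hr] at hn
    rw [div_lt_iff₀ (by positivity)]
    linarith
  obtain ⟨n, hn⟩ := hpow ε hε
  refine ⟨n, fun P Q _ hQ f hf => ?_⟩
  let η : ℝ := 1 / (2 * (2 ^ n + 1))
  have hη : 2 * η * (2 ^ n + 1) = 1 := by
    dsimp only [η]
    field_simp
  obtain ⟨δ, hδ, hfδ⟩ := Metric.uniformContinuous_iff.1 hf η (by positivity)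
  obtain ⟨M, hM⟩ := hpow δ hδ
  refine ⟨M, fun m hm => ?_⟩
  -- Room for two hops through a vertex `v`: from `u` to `u'`, both preceding `v`, or from `u` to a
  -- point of a simplex containing `v`.
  have hmδ : (1 : ℝ) / 2 ^ m + 1 / 2 ^ m < δ := by
    refine lt_of_le_of_lt ?_ hM
    rw [← add_div, one_add_one_eq_two]
    gcongr
    exact one_le_two
  let V : (P.sharpIter m).carrier → P.Realization := fun u =>
    P.canonicalIter m ((P.sharpIter m).baryEquiv (Preposet.Bary.pure u))
  have hV : ∀ u v, Relation.TransGen (P.sharpIter m).rel u v → dist (V u) (V v) ≤ 1 / 2 ^ m :=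
    fun u v h => P.dist_canonicalIter_pure_le m h
  obtain ⟨g, hg⟩ := Preposet.exists_hom_approx hQ n hη (fun u => f (V u)) fun v u u' hu hu' =>
    (hfδ ((dist_triangle_right _ _ (V v)).trans_lt
      ((add_le_add (hV u v hu) (hV u' v hu')).trans_lt hmδ))).le
  refine ⟨g, fun x => lt_of_le_of_lt ?_ hn⟩
  obtain ⟨z, rfl⟩ := (P.canonicalIter m).surjective x
  obtain ⟨w, rfl⟩ := (P.sharpIter m).baryEquiv.surjective z
  rw [Equiv.symm_apply_apply]
  refine Preposet.realization_dist_le (by positivity) fun q => ?_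
  rw [Preposet.canonicalIter_realize_apply]
  set y := f (P.canonicalIter m ((P.sharpIter m).baryEquiv w))
  have htot : ∑ v ∈ w.weight.support, w.weight v = 1 := w.total
  -- Both `y q` and the error bound are written as weighted means, so the estimate can be made
  -- vertex by vertex.
  have hmean : ∀ r : ℝ, r = ∑ v ∈ w.weight.support, w.weight v * r := fun r => by
    rw [← Finset.sum_mul, htot, one_mul]
  rw [hmean ((y : lp (fun _ : Q => ℝ) ∞) q), ← Finset.sum_sub_distrib]
  refine (Finset.abs_sum_le_sum_abs _ _).trans ?_
  rw [hmean (2 / 2 ^ n)]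
  refine Finset.sum_le_sum fun v hv => ?_
  rw [← mul_sub, abs_mul, abs_of_nonneg (w.nonneg v)]
  refine mul_le_mul_of_nonneg_left (hg v y (fun u hu => ?_) q) (w.nonneg v)
  exact (hfδ ((dist_triangle _ (V v) _).trans_lt ((add_le_add (hV u v hu)
    (P.dist_canonicalIter_pure_bary_le m w hv)).trans_lt hmδ))).le
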